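/- Let $\mathcal H$ be a complex Hilbert space and let $\mathcal R\subseteq\mathcal L(\mathcal H)$ be a von Neumann algebra. Suppose that $\mathcal R$ is of one of the following types: - type $I_n$ for some $n\in\{2,3,\dots\}\cup\{\infty\}$, i.e. the identity $I$ is the (strongly convergent) sum of $n$ (for $n=\infty$: of infinitely many) pairwise orthogonal abelian projections of $\mathcal R$ that are pairwise Murray–von Neumann equivalent in $\mathcal R$; - type $II$, i.e. $\mathcal R$ has no nonzero abelian projection but has a finite projection with central carrier $I$; - type $III$, i.e. $\mathcal R$ has no nonzero finite projection. Let $\phi$ be a normal state of $\mathcal R$, i.e. a positive linear functional $\phi:\mathcal R\to\mathbb C$ with $\phi(I)=1$ such that $\phi(\sup D)=\sup\phi(D)$ for every nonempty upward directed set $D$ of self-adjoint elements of $\mathcal R$ that has a least upper bound. Then there is a projection $E\in\mathcal R$ such that $$\phi(E)\notin\{0,1\}=\operatorname{sp}E .$$ Consequently, the restriction of $\phi$ to the self-adjoint part $\mathcal R_{sa}$ is not a valuation function. Here a valuation function is a map $v:\mathcal R_{sa}\to\mathbb R$ such that $v(A)\in\operatorname{sp}A$ for all $A\in\mathcal R_{sa}$,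 and $v(f(A))=f(v(A))$ for all $A\in\mathcal R_{sa}$ and all Borel functions $f:\mathbb R\to\mathbb R$ for which $f(A)$ (Borel functional calculus) is a bounded operator. -/

import Mathlib

open MeasureTheory

namespace KSNormal

section Projections

variable {M : Type*} [Ring M] [StarRing M]

/-- Murray-von Neumann equivalence `E ∼ F` relative to `M`: there is `θ ∈ M` with
`θ* θ = E` and `θ θ* = F`. -/
def MvNEquiv (E F : M) : Prop :=
  ∃ θ : M, star θ * θ = E ∧ θ * star θ = F

/-- `E` is an abelian projection of `M`: the corner `E M E` is commutative. -/
def IsAbelianProj (E : M) : Prop :=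
  IsStarProjection E ∧ ∀ A B : M, Commute (E * A * E) (E * B * E)

/-- `E` is a finite projection of `M`: it is not equivalent to a proper subprojection
(`F ≤ E` is expressed as `E * F = F`). -/
def IsFiniteProj (E : M) : Prop :=
  IsStarProjection E ∧
    ∀ F : M, IsStarProjection F → E * F = F → MvNEquiv E F → F = E

/-- The central carrier of `E` in `M` is the identity: the only central projection `Z` of `M`
with `E ≤ Z` is `1`. -/
def HasCentralCarrierOne (E : M) : Prop :=
  ∀ Z : M, IsStarProjection Z → (∀ A : M, Commute Z A) → Z * E = E → Z = 1

end Projections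

universe u

variable {H : Type u} [NormedAddCommGroup H] [InnerProductSpace ℂ H] [CompleteSpace H]

/-- `R` is of type `I_n`: the identity is the sum, in the strong operator topology, of `n`
pairwise orthogonal, pairwise equivalent abelian projections of `R`. The value `n = ⊤` is
type `I_∞`: infinitely many such projections. -/
def IsTypeI (R : VonNeumannAlgebra H) (n : ℕ∞) : Prop :=
  ∃ (ι : Type u) (E : ι → R.toStarSubalgebra),
    ENat.card ι = n ∧
    (∀ i, IsAbelianProj (E i)) ∧
    (∀ i j, i ≠ j → E i * E j = 0) ∧
    (∀ i j, MvNEquiv (E i) (E j)) ∧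
    ∀ x : H, HasSum (fun i => (E i : H →L[ℂ] H) x) x

/-- `R` is of type `II`: it has no nonzero abelian projection, but it has a finite projection
with central carrier `1`. -/
def IsTypeII (R : VonNeumannAlgebra H) : Prop :=
  (∀ E : R.toStarSubalgebra, IsAbelianProj E → E = 0) ∧
    ∃ E : R.toStarSubalgebra, IsFiniteProj E ∧ HasCentralCarrierOne E

/-- `R` is of type `III`: it has no nonzero finite projection. -/
def IsTypeIII (R : VonNeumannAlgebra H) : Prop :=
  ∀ E : R.toStarSubalgebra, IsFiniteProj E → E = 0

/-- A normal state of `R`: a positive linear functional with value `1` at the identity that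
preserves least upper bounds of upward directed sets of self-adjoint elements of `R`. The order
is the usual order of self-adjoint operators. -/
structure IsNormalState (R : VonNeumannAlgebra H) (φ : R.toStarSubalgebra →ₗ[ℂ] ℂ) : Prop where
  nonneg : ∀ A : R.toStarSubalgebra, 0 ≤ (φ (star A * A)).re ∧ (φ (star A * A)).im = 0
  map_one : φ 1 = 1
  normal : ∀ (D : Set (selfAdjoint R.toStarSubalgebra)) (A : selfAdjoint R.toStarSubalgebra),
    D.Nonempty → DirectedOn (· ≤ ·) D → IsLUB D A →
      IsLUB ((fun B : selfAdjoint R.toStarSubalgebra => (φ B).re) '' D) (φ A).re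

/-- `μ` is the scalar spectral measure of the self-adjoint operator `A` at the vector `x`: the
finite Borel measure carried by the spectrum of `A` with `∫ g dμ = ⟨x, g(A) x⟩` for all
continuous `g`, where `g(A)` is the continuous functional calculus. -/
def IsSpectralMeasure (A : H →L[ℂ] H) (x : H) (μ : Measure ℝ) : Prop :=
  IsFiniteMeasure μ ∧ μ (spectrum ℝ A)ᶜ = 0 ∧
    ∀ g : ℝ → ℝ, Continuous g → inner ℂ x (cfc g A x) = ((∫ t, g t ∂μ : ℝ) : ℂ)

/-- The bounded operator `B` is the value `f(A)` of the Borel functional calculus of the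
self-adjoint operator `A` at the Borel function `f`, that is, `⟨x, B x⟩ = ∫ f dμ` for every
vector `x`, with `μ` the spectral measure of `A` at `x`. -/
def IsBorelFunctionOf (f : ℝ → ℝ) (A B : H →L[ℂ] H) : Prop :=
  ∀ x : H, ∃ μ : Measure ℝ, IsSpectralMeasure A x μ ∧ Integrable f μ ∧
    inner ℂ x (B x) = ((∫ t, f t ∂μ : ℝ) : ℂ)

/-- A valuation function of `R`: a function `v` on the self-adjoint elements of `R` with
`v(A)` in the spectrum of `A`, and `v(f(A)) = f(v(A))` for all Borel functions `f : ℝ → ℝ`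
(for which `f(A)` is a bounded operator, so that `v` applies to it). -/
structure IsValuationFunction (R : VonNeumannAlgebra H)
    (v : selfAdjoint R.toStarSubalgebra → ℝ) : Prop where
  spectrum_rule : ∀ A : selfAdjoint R.toStarSubalgebra,
    v A ∈ spectrum ℝ ((A : R.toStarSubalgebra) : H →L[ℂ] H)
  func : ∀ f : ℝ → ℝ, Measurable f → ∀ A B : selfAdjoint R.toStarSubalgebra,
    IsBorelFunctionOf f ((A : R.toStarSubalgebra) : H →L[ℂ] H)
      ((B : R.toStarSubalgebra) : H →L[ℂ] H) → v B = f (v A)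

end KSNormal

namespace KSNormal

universe u

variable {H : Type u} [NormedAddCommGroup H] [InnerProductSpace ℂ H] [CompleteSpace H]

/-! Suppose `φ` takes only the values 0 and 1 on projections. Then it vanishes on any projection
with an orthogonal equivalent partner, because rotating one towards the other with varying phases
gives incompatible values (`IsDichotomic.eq_zero_of_equiv`). In type I, normality extends this
vanishing to the sum `1`, contradicting `φ 1 = 1`. For types II and III, normality and Zorn's lemma
give a maximal projection `N` with `φ N = 0`, and `1 - N` is a nonzero minimal projection
(`IsNormalState.exists_isMinimalProj`). A minimal projection is abelian, since its corner consists
of scalars, and an abelian projection is finite; neither type admits this. -/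

/-! ### Range projections and positive parts inside the algebra -/

/-- The projection onto the closure of the range of an operator. -/
noncomputable def rangeProj (T : H →L[ℂ] H) : H →L[ℂ] H :=
  T.range.topologicalClosure.starProjection

lemma isStarProjection_rangeProj (T : H →L[ℂ] H) : IsStarProjection (rangeProj T) :=
  isStarProjection_starProjection

lemma rangeProj_mul_self (T : H →L[ℂ] H) : rangeProj T * T = T := by
  ext x
  exact Submodule.starProjection_eq_self_iff.mpr
    (Submodule.le_topologicalClosure _ (LinearMap.mem_range_self _ x))

lemma mul_rangeProj_eq_zero {X T : H →L[ℂ] H} (h : X * T = 0) : X * rangeProj T = 0 := by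
  have hle : T.range.topologicalClosure ≤ X.ker := by
    refine Submodule.topologicalClosure_minimal _ ?_ X.isClosed_ker
    rintro _ ⟨x, rfl⟩
    exact DFunLike.congr_fun h x
  ext x
  exact hle (Submodule.starProjection_apply_mem _ x)

lemma mul_rangeProj_eq_self {X T : H →L[ℂ] H} (h : X * T = T) :
    X * rangeProj T = rangeProj T := by
  have := mul_rangeProj_eq_zero (X := X - 1) (T := T) (by rw [sub_mul, h, one_mul, sub_self])
  rwa [sub_mul, one_mul, sub_eq_zero] at this

/-- Every element of the commutant of `R` leaves the range of `T`, hence its closure, invariant. -/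
lemma rangeProj_mem (R : VonNeumannAlgebra H) {T : H →L[ℂ] H} (hT : T ∈ R) :
    rangeProj T ∈ R := by
  rw [VonNeumannAlgebra.IsStarProjection.mem_iff (isStarProjection_rangeProj T)]
  intro y hy
  have hyT := VonNeumannAlgebra.mem_commutant_iff.mp hy T hT
  rw [rangeProj, Submodule.range_starProjection, Module.End.mem_invtSubmodule]
  refine Submodule.topologicalClosure_minimal _ ?_
    ((Submodule.isClosed_topologicalClosure _).preimage y.continuous)
  rintro _ ⟨x, rfl⟩
  refine Submodule.le_topologicalClosure _ ⟨y x, ?_⟩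
  exact DFunLike.congr_fun hyT x

lemma posPart_mem (R : VonNeumannAlgebra H) {B : H →L[ℂ] H} (hB : B ∈ R) :
    B⁺ ∈ R := by
  rw [← VonNeumannAlgebra.commutant_commutant R, VonNeumannAlgebra.mem_commutant_iff]
  intro y hy
  have hyB : Commute B y := VonNeumannAlgebra.mem_commutant_iff.mp hy B hB
  rw [CFC.posPart_def]
  exact (Commute.cfcₙ_real hyB _).symm.eq

/-! ### Minimal projections are abelian -/

/-- A minimal projection is one whose only subprojections are `0` and itself. -/
def IsMinimalProj {M : Type*} [Ring M] [StarRing M] (S : M) : Prop :=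
  IsStarProjection S ∧ ∀ P : M, IsStarProjection P → S * P = P → P = 0 ∨ P = S

/-- The range projection of `B⁺` lies in `R` below `S`, so it is `0` or `S`. It being `0` kills
`B⁺`; it being `S` kills `B⁻ * S`, since `B⁻ * B⁺ = 0`. -/
lemma nonneg_or_nonpos_of_isMinimalProj (R : VonNeumannAlgebra H) {S : R.toStarSubalgebra}
    (hS : IsMinimalProj S) {B : H →L[ℂ] H} (hB : B ∈ R) (hs : IsSelfAdjoint B)
    (hBS : B * (S : H →L[ℂ] H) = B) : 0 ≤ B ∨ B ≤ 0 := by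
  have hsub := CFC.posPart_sub_negPart B hs
  have hpos : IsSelfAdjoint B⁺ := (CFC.posPart_nonneg B).isSelfAdjoint
  have hSs : star (S : H →L[ℂ] H) = S := congrArg Subtype.val hS.1.isSelfAdjoint.star_eq
  have hpS : B⁺ * (S : H →L[ℂ] H) = B⁺ := by
    have hBB : B⁺ * B = B⁺ * B⁺ := by
      have := congrArg (B⁺ * ·) hsub
      simp only [mul_sub, CFC.posPart_mul_negPart, sub_zero] at this
      exact this.symm
    -- One factor `B⁺` turns the other into `B`, which vanishes on `1 - S`; the C*-identity then
    -- removes the extra factor.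
    have h1 : B⁺ * (B⁺ * (1 - (S : H →L[ℂ] H))) = 0 := by
      rw [← mul_assoc, ← hBB, mul_assoc, mul_sub, mul_one, hBS, sub_self, mul_zero]
    have h2 : B⁺ * (1 - (S : H →L[ℂ] H)) = 0 := by
      rw [← CStarRing.star_mul_self_eq_zero_iff, star_mul, hpos.star_eq, mul_assoc, h1, mul_zero]
    rwa [mul_sub, mul_one, sub_eq_zero, eq_comm] at h2
  have hSp : (S : H →L[ℂ] H) * B⁺ = B⁺ := by
    have := congrArg star hpS
    rwa [star_mul, hpos.star_eq, hSs] at this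
  let Q : R.toStarSubalgebra := ⟨rangeProj B⁺, rangeProj_mem R (posPart_mem R hB)⟩
  have hQ : IsStarProjection Q :=
    ⟨Subtype.ext (isStarProjection_rangeProj B⁺).isIdempotentElem.eq,
      Subtype.ext (isStarProjection_rangeProj B⁺).isSelfAdjoint.star_eq⟩
  rcases hS.2 Q hQ (Subtype.ext (mul_rangeProj_eq_self hSp)) with h | h
  · right
    have h0 : rangeProj B⁺ = 0 := congrArg Subtype.val h
    have h1 : B⁺ = 0 := by rw [← rangeProj_mul_self B⁺, h0, zero_mul]
    rw [← hsub, h1, zero_sub, Left.neg_nonpos_iff]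
    exact CFC.negPart_nonneg B
  · left
    have h0 : rangeProj B⁺ = (S : H →L[ℂ] H) := congrArg Subtype.val h
    have h1 : B⁻ * (S : H →L[ℂ] H) = 0 :=
      h0 ▸ mul_rangeProj_eq_zero (CFC.negPart_mul_posPart B)
    have h2 : B = B⁺ := by
      conv_lhs => rw [← hBS, ← hsub, sub_mul, h1, sub_zero, hpS]
    rw [h2]
    exact CFC.posPart_nonneg B

/-- Each `A - t • S` has a definite sign. Testing on one unit of the range of `S` decides that sign
for `t ≠ c`, and letting `t → c` from both sides pins the quadratic form of `A` to that of `c • S`.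
-/
lemma exists_eq_smul_of_isMinimalProj (R : VonNeumannAlgebra H) {S : R.toStarSubalgebra}
    (hS : IsMinimalProj S) {A : H →L[ℂ] H} (hA : A ∈ R) (hs : IsSelfAdjoint A)
    (hAS : A * (S : H →L[ℂ] H) = A) : ∃ c : ℝ, A = (c : ℂ) • (S : H →L[ℂ] H) := by
  have hSp : IsStarProjection (S : H →L[ℂ] H) :=
    ⟨congrArg Subtype.val hS.1.isIdempotentElem.eq, congrArg Subtype.val hS.1.isSelfAdjoint.star_eq⟩
  by_cases hS0 : (S : H →L[ℂ] H) = 0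
  · exact ⟨0, by rw [← hAS, hS0]; simp⟩
  obtain ⟨x, hx⟩ : ∃ x, (S : H →L[ℂ] H) x ≠ 0 := by
    by_contra! h
    exact hS0 (ContinuousLinearMap.ext h)
  set y : H := (S : H →L[ℂ] H) x with hy
  have hSy : (S : H →L[ℂ] H) y = y := DFunLike.congr_fun hSp.isIdempotentElem.eq x
  have hn : 0 < ‖y‖ ^ 2 := by positivity
  -- The Rayleigh quotient of `A` at `y`: the value of `t` at which the form of `A - t • S` changes
  -- sign at `y`.
  set c : ℝ := A.reApplyInnerSelf y / ‖y‖ ^ 2 with hc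
  have hquad : ∀ (t : ℝ) (z : H), (A - (t : ℂ) • (S : H →L[ℂ] H)).reApplyInnerSelf z =
      A.reApplyInnerSelf z - t * (S : H →L[ℂ] H).reApplyInnerSelf z := by
    intro t z
    simp only [ContinuousLinearMap.reApplyInnerSelf_apply, sub_apply, smul_apply, inner_sub_left,
      inner_smul_left, map_sub, Complex.conj_ofReal]
    simp
  have hqy : ∀ t : ℝ, (A - (t : ℂ) • (S : H →L[ℂ] H)).reApplyInnerSelf y =
      (c - t) * ‖y‖ ^ 2 := by
    intro t
    rw [hquad, ContinuousLinearMap.reApplyInnerSelf_apply (S : H →L[ℂ] H), hSy,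
      inner_self_eq_norm_sq, hc]
    field_simp
  have hdich : ∀ t : ℝ, 0 ≤ A - (t : ℂ) • (S : H →L[ℂ] H) ∨
      A - (t : ℂ) • (S : H →L[ℂ] H) ≤ 0 := by
    intro t
    refine nonneg_or_nonpos_of_isMinimalProj R hS ?_ ?_ ?_
    · exact R.toStarSubalgebra.sub_mem hA (R.toStarSubalgebra.smul_mem S.2 _)
    · refine hs.sub ?_
      rw [IsSelfAdjoint, star_smul, hSp.isSelfAdjoint.star_eq]
      simp
    · rw [sub_mul, hAS, smul_mul_assoc, hSp.isIdempotentElem.eq]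
  have hpos : ∀ {T : H →L[ℂ] H}, 0 ≤ T → ∀ z, 0 ≤ T.reApplyInnerSelf z := by
    intro T hT z
    exact ((ContinuousLinearMap.nonneg_iff_isPositive T).mp hT).re_inner_nonneg_left z
  have hneg : ∀ {T : H →L[ℂ] H}, T ≤ 0 → ∀ z, T.reApplyInnerSelf z ≤ 0 := by
    intro T hT z
    have := hpos (neg_nonneg.mpr hT) z
    simpa [ContinuousLinearMap.reApplyInnerSelf_apply] using this
  have hlow : ∀ z, A.reApplyInnerSelf z ≤ c * (S : H →L[ℂ] H).reApplyInnerSelf z := by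
    intro z
    have hcl : ∀ t : ℝ, c < t → A.reApplyInnerSelf z ≤ t * (S : H →L[ℂ] H).reApplyInnerSelf z := by
      intro t ht
      rcases hdich t with h | h
      · have := hpos h y
        rw [hqy] at this
        nlinarith
      · have := hneg h z
        rw [hquad] at this
        linarith
    refine ge_of_tendsto (x := nhdsWithin c (Set.Ioi c))
      (f := fun t : ℝ => t * (S : H →L[ℂ] H).reApplyInnerSelf z) ?_
      (Filter.eventually_of_mem self_mem_nhdsWithin fun t ht => hcl t ht)
    exact ((continuous_id.mul continuous_const).tendsto c).mono_left nhdsWithin_le_nhds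
  have hupp : ∀ z, c * (S : H →L[ℂ] H).reApplyInnerSelf z ≤ A.reApplyInnerSelf z := by
    intro z
    have hcl : ∀ t : ℝ, t < c → t * (S : H →L[ℂ] H).reApplyInnerSelf z ≤ A.reApplyInnerSelf z := by
      intro t ht
      rcases hdich t with h | h
      · have := hpos h z
        rw [hquad] at this
        linarith
      · have := hneg h y
        rw [hqy] at this
        nlinarith
    refine le_of_tendsto (x := nhdsWithin c (Set.Iio c))
      (f := fun t : ℝ => t * (S : H →L[ℂ] H).reApplyInnerSelf z) ?_
      (Filter.eventually_of_mem self_mem_nhdsWithin fun t ht => hcl t ht)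
    exact ((continuous_id.mul continuous_const).tendsto c).mono_left nhdsWithin_le_nhds
  refine ⟨c, ?_⟩
  rw [← sub_eq_zero]
  rcases hdich c with h | h
  all_goals
    set T := A - (c : ℂ) • (S : H →L[ℂ] H) with hT
    have hz : ∀ z, T.reApplyInnerSelf z = 0 := fun z => by
      rw [hquad]; linarith [hlow z, hupp z]
    refine le_antisymm ?_ ?_
  · rw [ContinuousLinearMap.le_def, zero_sub, ContinuousLinearMap.isPositive_def']
    exact ⟨h.isSelfAdjoint.neg, fun z => by
      have := hz z
      simp [ContinuousLinearMap.reApplyInnerSelf_apply] at this ⊢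
      linarith⟩
  · exact h
  · exact h
  · rw [ContinuousLinearMap.nonneg_iff_isPositive, ContinuousLinearMap.isPositive_def']
    refine ⟨?_, fun z => (hz z).ge⟩
    simpa using (neg_nonneg.mpr h).isSelfAdjoint.neg

lemma IsMinimalProj.isAbelianProj (R : VonNeumannAlgebra H) {S : R.toStarSubalgebra}
    (hS : IsMinimalProj S) : IsAbelianProj S := by
  refine ⟨hS.1, fun A B => ?_⟩
  have hSS : S * S = S := hS.1.isIdempotentElem.eq
  have hSs : star S = S := hS.1.isSelfAdjoint.star_eq
  have hself : ∀ A : R.toStarSubalgebra, IsSelfAdjoint A → ∃ c : ℂ, S * A * S = c • S := by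
    intro A hA
    have h1 : IsSelfAdjoint (S * A * S) := by
      rw [IsSelfAdjoint, star_mul, star_mul, hSs, hA.star_eq, mul_assoc]
    obtain ⟨c, hc⟩ := exists_eq_smul_of_isMinimalProj R hS (S * A * S).2
      (congrArg Subtype.val h1.star_eq) (congrArg Subtype.val (show S * A * S * S = S * A * S by
        rw [mul_assoc _ S S, hSS]))
    exact ⟨c, Subtype.ext hc⟩
  have hall : ∃ c : ℂ, S * A * S = c • S := by
    obtain ⟨a, ha⟩ := hself _ (realPart A).2
    obtain ⟨b, hb⟩ := hself _ (imaginaryPart A).2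
    refine ⟨a + Complex.I * b, ?_⟩
    conv_lhs => rw [← realPart_add_I_smul_imaginaryPart A]
    rw [mul_add, add_mul, ha, mul_smul_comm, smul_mul_assoc, hb, smul_smul, add_smul]
  obtain ⟨a, ha⟩ := hall
  rw [ha, commute_iff_eq, smul_mul_assoc, mul_smul_comm, ← mul_assoc, ← mul_assoc, hSS,
    mul_assoc _ S S, hSS]

/-! ### Strong limits and normality -/

open Filter Topology in
lemma le_of_tendsto_strong {ι : Type*} {l : Filter ι} [l.NeBot] {T : ι → H →L[ℂ] H}
    {A B : H →L[ℂ] H} (hA : IsSelfAdjoint A) (hB : IsSelfAdjoint B)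
    (hT : ∀ x, Tendsto (fun i => T i x) l (𝓝 (A x))) (hle : ∀ᶠ i in l, T i ≤ B) : A ≤ B := by
  rw [ContinuousLinearMap.le_def, ContinuousLinearMap.isPositive_def']
  refine ⟨hB.sub hA, fun x => ?_⟩
  have hlim : Tendsto (fun i => (B - T i).reApplyInnerSelf x) l
      (𝓝 ((B - A).reApplyInnerSelf x)) := by
    simp only [ContinuousLinearMap.reApplyInnerSelf_apply, sub_apply]
    exact RCLike.continuous_re.continuousAt.tendsto.comp
      ((tendsto_const_nhds.sub (hT x)).inner tendsto_const_nhds)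
  exact ge_of_tendsto hlim (hle.mono fun i hi =>
    ((ContinuousLinearMap.le_def _ _).mp hi).re_inner_nonneg_left x)

/-- A normal state vanishes at the strong limit of an increasing net at which it vanishes. -/
lemma IsNormalState.re_eq_zero_of_tendsto {R : VonNeumannAlgebra H}
    {φ : R.toStarSubalgebra →ₗ[ℂ] ℂ} (hφ : IsNormalState R φ) {ι : Type*} [Preorder ι]
    [IsDirectedOrder ι] [Nonempty ι] {P : ι → R.toStarSubalgebra} {A : R.toStarSubalgebra}
    (hP : ∀ i, IsSelfAdjoint (P i)) (hA : IsSelfAdjoint A)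
    (hmono : ∀ i j, i ≤ j → (P i : H →L[ℂ] H) ≤ P j) (hzero : ∀ i, φ (P i) = 0)
    (hlim : ∀ x, Filter.Tendsto (fun i => (P i : H →L[ℂ] H) x) Filter.atTop
      (nhds ((A : H →L[ℂ] H) x))) : (φ A).re = 0 := by
  have coe : ∀ {T : R.toStarSubalgebra}, IsSelfAdjoint T → IsSelfAdjoint (T : H →L[ℂ] H) :=
    fun h => congrArg Subtype.val h.star_eq
  let p : ι → selfAdjoint R.toStarSubalgebra := fun i => ⟨P i, hP i⟩
  have hdir : DirectedOn (· ≤ ·) (Set.range p) := by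
    rintro _ ⟨i, rfl⟩ _ ⟨j, rfl⟩
    obtain ⟨k, hi, hj⟩ := exists_ge_ge i j
    exact ⟨p k, ⟨k, rfl⟩, hmono i k hi, hmono j k hj⟩
  have hlub : IsLUB (Set.range p) ⟨A, hA⟩ := by
    constructor
    · rintro _ ⟨i, rfl⟩
      -- Negation turns the lower bound `P i` on the tail of the net into an upper bound.
      have hneg : -(A : H →L[ℂ] H) ≤ -(P i : H →L[ℂ] H) := by
        refine le_of_tendsto_strong (l := Filter.atTop) (T := fun j => -(P j : H →L[ℂ] H))
          (coe hA).neg (coe (hP i)).neg (fun x => (hlim x).neg) ?_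
        filter_upwards [Filter.eventually_ge_atTop i] with j hj
        exact neg_le_neg (hmono i j hj)
      exact neg_le_neg_iff.mp hneg
    · intro B hB
      exact le_of_tendsto_strong (l := Filter.atTop) (coe hA) (coe B.2) hlim
        (Filter.Eventually.of_forall fun i => hB ⟨i, rfl⟩)
  have h := hφ.normal _ _ (Set.range_nonempty p) hdir hlub
  have himg : (fun B : selfAdjoint R.toStarSubalgebra => (φ B).re) '' Set.range p = {0} := by
    rw [← Set.range_comp]
    have : (fun B : selfAdjoint R.toStarSubalgebra => (φ B).re) ∘ p = fun _ => 0 := by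
      funext i
      simp [p, hzero]
    rw [this, Set.range_const]
  rw [himg] at h
  exact h.unique isLUB_singleton

/-! ### Dichotomic functionals and equivalent projections -/

/-- A functional taking only the values `0` and `1` on projections. -/
def IsDichotomic {M : Type*} [Ring M] [StarRing M] [Module ℂ M] (φ : M →ₗ[ℂ] ℂ) : Prop :=
  ∀ P : M, IsStarProjection P → φ P = 0 ∨ φ P = 1

section Algebraic

variable {M : Type*} [Ring M] [StarRing M] [Algebra ℂ M] [StarModule ℂ M]

/-- The projection obtained by rotating `E` halfway towards the equivalent projection `F`. -/
lemma isStarProjection_half_rotation {E F θ : M} (hE : IsStarProjection E)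
    (hF : IsStarProjection F) (hEF : E * F = 0) (h1 : star θ * θ = E) (h2 : θ * star θ = F)
    (h3 : θ * E = θ) (h4 : F * θ = θ) {u : ℂ} (hu : u * star u = 1) :
    IsStarProjection ((2⁻¹ : ℂ) • (E + F + u • θ + star u • star θ)) := by
  have hEs := hE.isSelfAdjoint.star_eq
  have hFs := hF.isSelfAdjoint.star_eq
  have hFE : F * E = 0 := by
    have := congrArg star hEF
    rwa [star_mul, hEs, hFs, star_zero] at this
  have h3' : E * star θ = star θ := by
    have := congrArg star h3
    rwa [star_mul, hEs] at this
  have h4' : star θ * F = star θ := by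
    have := congrArg star h4
    rwa [star_mul, hFs] at this
  have h5 : E * θ = 0 := by rw [← h4, ← mul_assoc, hEF, zero_mul]
  have h6 : θ * F = 0 := by rw [← h3, mul_assoc, hEF, mul_zero]
  have h5' : star θ * E = 0 := by rw [← h4', mul_assoc, hFE, mul_zero]
  have h6' : F * star θ = 0 := by rw [← h3', ← mul_assoc, hFE, zero_mul]
  have h7 : θ * θ = 0 := by
    rw [← congrArg (· * θ) h3, mul_assoc, h5, mul_zero]
  have h7' : star θ * star θ = 0 := by rw [← star_mul, h7, star_zero]
  constructor
  · rw [IsIdempotentElem, smul_mul_smul_comm]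
    simp only [add_mul, mul_add, smul_mul_assoc, mul_smul_comm, hE.isIdempotentElem.eq,
      hF.isIdempotentElem.eq, hEF, hFE, h1, h2, h3, h4, h3', h4', h5, h6, h5', h6', h7, h7',
      smul_zero, add_zero, zero_add]
    match_scalars <;> first | ring1 | linear_combination (1 / 4 : ℂ) * hu
  · rw [IsSelfAdjoint, star_smul]
    simp only [star_add, star_smul, star_star, hEs, hFs]
    rw [show star (2⁻¹ : ℂ) = 2⁻¹ by simp]
    congr 1
    abel

/-- If `φ E = 1`, then `φ F = 0`, and dichotomy on the half rotations forces `u * φ θ + star u * φ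
(star θ)` to be `1` or `-1` for every phase `u`. This expression is linear in the real and imaginary
parts of `u`, so three phases already contradict it. -/
lemma IsDichotomic.eq_zero_of_equiv {φ : M →ₗ[ℂ] ℂ} (hφ : IsDichotomic φ) {E F : M}
    (hE : IsStarProjection E) (hF : IsStarProjection F) (hEF : E * F = 0) {θ : M}
    (h1 : star θ * θ = E) (h2 : θ * star θ = F) (h3 : θ * E = θ) (h4 : F * θ = θ) :
    φ E = 0 := by
  have key : ∀ u : ℂ, u * star u = 1 →
      φ E + φ F + u * φ θ + star u * φ (star θ) = 0 ∨
        φ E + φ F + u * φ θ + star u * φ (star θ) = 2 := by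
    intro u hu
    have := hφ _ (isStarProjection_half_rotation hE hF hEF h1 h2 h3 h4 hu)
    simp only [map_smul, map_add, smul_eq_mul] at this
    rcases this with h | h
    · left; linear_combination 2 * h
    · right; linear_combination 2 * h
  rcases hφ E hE with h | hE1
  · exact h
  exfalso
  have hF0 : φ F = 0 := by
    have hs := hφ _ (hE.add hF hEF)
    rw [map_add, hE1] at hs
    rcases hφ F hF with h | h
    · exact h
    · rw [h] at hs
      norm_num at hs
  rw [hE1, hF0] at key
  have k1 := key 1 (by simp)
  have k2 := key Complex.I (by simp)
  -- A rational point of the unit circle: with `s` and `d` equal to `±1`, `3 * s + 4 * d` is `±1` or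
  -- `±7`, never `±5`.
  have k3 := key (3 / 5 + 4 / 5 * Complex.I) (by
    simp only [Complex.star_def, map_add, map_mul, map_div₀, Complex.conj_I, map_ofNat]
    linear_combination (-16 / 25) * Complex.I_sq)
  simp only [Complex.star_def, map_add, map_mul, map_div₀, Complex.conj_I, map_ofNat,
    map_one] at k1 k2 k3
  set s := φ θ + φ (star θ) with hs
  set d := Complex.I * (φ θ - φ (star θ)) with hd
  have e1 : s = 1 ∨ s = -1 := by
    rcases k1 with h | h
    · right; linear_combination h
    · left; linear_combination h
  have e2 : d = 1 ∨ d = -1 := by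
    rcases k2 with h | h
    · right; linear_combination h
    · left; linear_combination h
  have e3 : 3 * s + 4 * d = 5 ∨ 3 * s + 4 * d = -5 := by
    rcases k3 with h | h
    · right; linear_combination 5 * h
    · left; linear_combination 5 * h
  rcases e1 with e1 | e1 <;> rcases e2 with e2 | e2 <;> rw [e1, e2] at e3 <;> norm_num at e3

end Algebraic

lemma mul_eq_self_of_star_mul_self {M : Type*} [NormedRing M] [StarRing M] [CStarRing M]
    {E θ : M} (hE : IsStarProjection E) (h : star θ * θ = E) : θ * E = θ := by
  have h0 : θ * (1 - E) = 0 := by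
    rw [← CStarRing.star_mul_self_eq_zero_iff, star_mul, mul_assoc, ← mul_assoc (star θ), h,
      hE.mul_one_sub_self, mul_zero]
  rwa [mul_sub, mul_one, sub_eq_zero, eq_comm] at h0

/-- A partial isometry from `E` to a subprojection lies in the corner of `E`, so it commutes with
its adjoint and its two projections agree. -/
lemma IsAbelianProj.isFiniteProj (R : VonNeumannAlgebra H) {E : R.toStarSubalgebra}
    (hE : IsAbelianProj E) : IsFiniteProj E := by
  refine ⟨hE.1, ?_⟩
  rintro F hF hEF ⟨θ, h1, h2⟩
  have h3 : θ * E = θ := mul_eq_self_of_star_mul_self hE.1 h1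
  have h4 : F * θ = θ := by rw [← h2, mul_assoc, h1, h3]
  have h5 : E * θ = θ := by rw [← h4, ← mul_assoc, hEF]
  have h6 : E * θ * E = θ := by rw [h5, h3]
  have h7 : E * star θ * E = star θ := by
    have := congrArg star h6
    rwa [star_mul, star_mul, hE.1.isSelfAdjoint.star_eq, ← mul_assoc] at this
  have := hE.2 θ (star θ)
  rw [h6, h7, commute_iff_eq, h1, h2] at this
  exact this

/-! ### Zorn's lemma and existence of a minimal projection -/

/-- The least upper bound of a chain of projections of a von Neumann algebra is again a
projection of the algebra, and is the strong limit of the chain. -/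
lemma exists_isStarProjection_tendsto {R : VonNeumannAlgebra H} {c : Set R.toStarSubalgebra}
    (hc : ∀ P ∈ c, IsStarProjection P) (hchain : IsChain (· ≤ ·) c) (hne : c.Nonempty) :
    ∃ A : R.toStarSubalgebra, IsStarProjection A ∧ (∀ P ∈ c, P ≤ A) ∧
      ∀ x, Filter.Tendsto (fun P : c => ((P : R.toStarSubalgebra) : H →L[ℂ] H) x) Filter.atTop
        (nhds ((A : H →L[ℂ] H) x)) := by
  have hc' : ∀ P : c, IsStarProjection ((P : R.toStarSubalgebra) : H →L[ℂ] H) := fun P =>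
    ⟨congrArg Subtype.val (hc P P.2).isIdempotentElem.eq,
      congrArg Subtype.val (hc P P.2).isSelfAdjoint.star_eq⟩
  let U : c → Submodule ℂ H := fun P => ((P : R.toStarSubalgebra) : H →L[ℂ] H).range
  have hU : ∀ P, (U P).HasOrthogonalProjection := fun P =>
    (isStarProjection_iff_eq_starProjection_range.mp (hc' P)).1
  have hUP : ∀ P : c, ((P : R.toStarSubalgebra) : H →L[ℂ] H) = (U P).starProjection := fun P =>
    (isStarProjection_iff_eq_starProjection_range.mp (hc' P)).2
  have hmono : Monotone U := by
    intro P Q hPQ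
    rw [← Submodule.starProjection_le_starProjection_iff, ← hUP, ← hUP]
    exact hPQ
  have : Nonempty c := hne.to_subtype
  have : IsDirectedOrder c := ⟨fun P Q => by
    rcases hchain.total P.2 Q.2 with h | h
    · exact ⟨Q, h, le_rfl⟩
    · exact ⟨P, le_rfl, h⟩⟩
  set A : H →L[ℂ] H := (⨆ P, U P).topologicalClosure.starProjection with hA
  have hlim : ∀ x, Filter.Tendsto (fun P : c => ((P : R.toStarSubalgebra) : H →L[ℂ] H) x)
      Filter.atTop (nhds (A x)) := by
    intro x
    simp only [hUP]
    exact Submodule.starProjection_tendsto_closure_iSup U hmono x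
  have hAp : IsStarProjection A := isStarProjection_starProjection
  have hAR : A ∈ R := by
    rw [← VonNeumannAlgebra.commutant_commutant R, VonNeumannAlgebra.mem_commutant_iff]
    intro y hy
    ext x
    refine tendsto_nhds_unique ((y.continuous.tendsto _).comp (hlim x)) ((hlim (y x)).congr ?_)
    intro P
    exact DFunLike.congr_fun (VonNeumannAlgebra.mem_commutant_iff.mp hy _ P.1.2) x
  refine ⟨⟨A, hAR⟩, ⟨Subtype.ext hAp.isIdempotentElem.eq, Subtype.ext hAp.isSelfAdjoint.star_eq⟩,
    fun P hP => ?_, hlim⟩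
  change (P : H →L[ℂ] H) ≤ A
  rw [hUP ⟨P, hP⟩, hA, Submodule.starProjection_le_starProjection_iff]
  exact (le_iSup U ⟨P, hP⟩).trans (Submodule.le_topologicalClosure _)

/-- A dichotomic normal state does not vanish at some minimal projection. -/
lemma IsNormalState.exists_isMinimalProj {R : VonNeumannAlgebra H}
    {φ : R.toStarSubalgebra →ₗ[ℂ] ℂ} (hφ : IsNormalState R φ) (hd : IsDichotomic φ) :
    ∃ S : R.toStarSubalgebra, IsMinimalProj S ∧ S ≠ 0 := by
  obtain ⟨N, -, ⟨hN, hN0⟩, hmax⟩ := zorn_le_nonempty₀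
    {P : R.toStarSubalgebra | IsStarProjection P ∧ φ P = 0} (by
      intro c hc hchain P hP
      have hne : c.Nonempty := ⟨P, hP⟩
      obtain ⟨A, hA, hub, hlim⟩ :=
        exists_isStarProjection_tendsto (fun P hP => (hc hP).1) hchain hne
      have : Nonempty c := hne.to_subtype
      have : IsDirectedOrder c := ⟨fun P Q => by
        rcases hchain.total P.2 Q.2 with h | h
        · exact ⟨Q, h, le_rfl⟩
        · exact ⟨P, le_rfl, h⟩⟩
      refine ⟨A, ⟨hA, ?_⟩, hub⟩
      have hre := hφ.re_eq_zero_of_tendsto (P := fun P : c => (P : R.toStarSubalgebra))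
        (fun P => (hc P.2).1.isSelfAdjoint) hA.isSelfAdjoint (fun _ _ h => h)
        (fun P => (hc P.2).2) hlim
      rcases hd A hA with h | h
      · exact h
      · rw [h] at hre
        norm_num at hre) 0 ⟨IsStarProjection.zero _, map_zero φ⟩
  refine ⟨1 - N, ⟨hN.one_sub, fun P hP hSP => ?_⟩, fun h => ?_⟩
  · have hNP : N * P = 0 := by
      rwa [sub_mul, one_mul, sub_eq_self] at hSP
    -- A null projection orthogonal to `N` could be added to `N`, so maximality makes it zero. It is
    -- applied to `P` or to `1 - N - P`, whichever is null.
    have hvanish : ∀ Q : R.toStarSubalgebra, IsStarProjection Q → N * Q = 0 → φ Q = 0 →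
        Q = 0 := by
      intro Q hQ hNQ hQ0
      have hQpos : (0 : H →L[ℂ] H) ≤ (Q : H →L[ℂ] H) := by
        rw [ContinuousLinearMap.nonneg_iff_isPositive]
        exact .of_isStarProjection ⟨congrArg Subtype.val hQ.isIdempotentElem.eq,
          congrArg Subtype.val hQ.isSelfAdjoint.star_eq⟩
      have hle : (N : H →L[ℂ] H) ≤ (N : H →L[ℂ] H) + Q := le_add_of_nonneg_right hQpos
      have hge := hmax (y := N + Q) ⟨hN.add hQ hNQ, by rw [map_add, hN0, hQ0, add_zero]⟩ hle
      have heq : (N : H →L[ℂ] H) + Q = N := le_antisymm hge hle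
      exact Subtype.ext (by simpa using heq)
    rcases hd P hP with h | h
    · exact Or.inl (hvanish P hP hNP h)
    · right
      have hPS : P * (1 - N) = P := by
        have := congrArg star hSP
        rwa [star_mul, hP.isSelfAdjoint.star_eq, hN.one_sub.isSelfAdjoint.star_eq] at this
      have h0 := hvanish (1 - N - P) (hP.sub_of_mul_eq_left hN.one_sub hPS)
        (by rw [mul_sub, hN.mul_one_sub_self, hNP, sub_zero])
        (by rw [map_sub, map_sub, hφ.map_one, hN0, h]; ring)
      exact (sub_eq_zero.mp h0).symm
  · have h1 := congrArg φ h
    rw [map_sub, hφ.map_one, hN0, map_zero] at h1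
    norm_num at h1

/-! ### The types, and the conclusion -/

lemma IsNormalState.not_isDichotomic_of_isTypeI {R : VonNeumannAlgebra H}
    {φ : R.toStarSubalgebra →ₗ[ℂ] ℂ} (hφ : IsNormalState R φ) {n : ℕ∞} (hn : 2 ≤ n)
    (hR : IsTypeI R n) : ¬ IsDichotomic φ := by
  intro hd
  obtain ⟨ι, E, hcard, hab, horth, heq, hsum⟩ := hR
  have : Nontrivial ι := by
    rw [← ENat.one_lt_card_iff_nontrivial, hcard]
    exact lt_of_lt_of_le (by norm_num) hn
  have hE0 : ∀ i, φ (E i) = 0 := by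
    intro i
    obtain ⟨j, hj⟩ := exists_ne i
    obtain ⟨θ, h1, h2⟩ := heq i j
    have h3 : θ * E i = θ := mul_eq_self_of_star_mul_self (hab i).1 h1
    exact hd.eq_zero_of_equiv (hab i).1 (hab j).1 (horth i j hj.symm) h1 h2 h3
      (by rw [← h2, mul_assoc, h1, h3])
  -- The finite partial sums increase strongly to `1`, and `φ` vanishes on each.
  have hre := hφ.re_eq_zero_of_tendsto (P := fun s : Finset ι => ∑ i ∈ s, E i) (A := 1)
    (fun s => isSelfAdjoint_sum s fun i _ => (hab i).1.isSelfAdjoint) (IsSelfAdjoint.one _)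
    (fun s t hst => by
      simp only [AddSubmonoidClass.coe_finsetSum]
      refine Finset.sum_le_sum_of_subset_of_nonneg hst fun i _ _ => ?_
      rw [ContinuousLinearMap.nonneg_iff_isPositive]
      exact .of_isStarProjection ⟨congrArg Subtype.val (hab i).1.isIdempotentElem.eq,
        congrArg Subtype.val (hab i).1.isSelfAdjoint.star_eq⟩)
    (fun s => by simp [hE0])
    (fun x => by simpa [HasSum] using hsum x)
  rw [hφ.map_one] at hre
  norm_num at hre

lemma IsNormalState.not_isDichotomic {R : VonNeumannAlgebra H}
    {φ : R.toStarSubalgebra →ₗ[ℂ] ℂ} (hφ : IsNormalState R φ)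
    (hR : (∃ n : ℕ∞, 2 ≤ n ∧ IsTypeI R n) ∨ IsTypeII R ∨ IsTypeIII R) : ¬ IsDichotomic φ := by
  rcases hR with ⟨n, hn, h⟩ | h | h
  · exact hφ.not_isDichotomic_of_isTypeI hn h
  all_goals
    intro hd
    obtain ⟨S, hS, hS0⟩ := hφ.exists_isMinimalProj hd
  · exact hS0 (h.1 S (hS.isAbelianProj R))
  · exact hS0 (h S ((hS.isAbelianProj R).isFiniteProj R))

lemma spectrum_eq_of_isStarProjection {A : Type*} [Ring A] [StarRing A] [Algebra ℂ A] {E : A}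
    (hE : IsStarProjection E) (h0 : E ≠ 0) (h1 : E ≠ 1) : spectrum ℂ E = {0, 1} := by
  refine (hE.isIdempotentElem.spectrum_subset ℂ).antisymm ?_
  rintro z (rfl | rfl)
  · rw [spectrum.zero_mem_iff]
    intro hu
    refine h1 (hu.mul_left_cancel ?_)
    rw [hE.isIdempotentElem.eq, mul_one]
  · rw [spectrum.mem_iff, map_one]
    intro hu
    refine h0 (hu.mul_left_cancel ?_)
    rw [hE.one_sub_mul_self, mul_zero]

end KSNormal

theorem mainTheorem6 {H : Type*} [NormedAddCommGroup H] [InnerProductSpace ℂ H] [CompleteSpace H]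
    (R : VonNeumannAlgebra H)
    (hR : (∃ n : ℕ∞, 2 ≤ n ∧ KSNormal.IsTypeI R n) ∨ KSNormal.IsTypeII R ∨ KSNormal.IsTypeIII R)
    (φ : R.toStarSubalgebra →ₗ[ℂ] ℂ) (hφ : KSNormal.IsNormalState R φ) :
    (∃ E : R.toStarSubalgebra, IsStarProjection E ∧
      spectrum ℂ (E : H →L[ℂ] H) = {0, 1} ∧ φ E ∉ ({0, 1} : Set ℂ)) ∧
    ∀ v : selfAdjoint R.toStarSubalgebra → ℝ,
      (∀ A : selfAdjoint R.toStarSubalgebra, (v A : ℂ) = φ A) →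
        ¬ KSNormal.IsValuationFunction R v := by
  have hnot := hφ.not_isDichotomic hR
  simp only [KSNormal.IsDichotomic, not_forall] at hnot
  obtain ⟨E, hE, hφE⟩ := hnot
  have hE' : IsStarProjection (E : H →L[ℂ] H) :=
    ⟨congrArg Subtype.val hE.isIdempotentElem.eq, congrArg Subtype.val hE.isSelfAdjoint.star_eq⟩
  refine ⟨⟨E, hE, KSNormal.spectrum_eq_of_isStarProjection hE' ?_ ?_, hφE⟩, fun v hv hval => ?_⟩
  · intro h
    have : E = 0 := Subtype.ext h
    exact hφE (Or.inl (by rw [this, map_zero]))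
  · intro h
    have : E = 1 := Subtype.ext h
    exact hφE (Or.inr (by rw [this, hφ.map_one]))
  -- The spectrum rule alone is violated: it would put `φ E` in `{0, 1}`.
  · have hmem := hE'.isIdempotentElem.spectrum_subset ℝ
      (hval.spectrum_rule ⟨E, hE.isSelfAdjoint⟩)
    have hvE := hv ⟨E, hE.isSelfAdjoint⟩
    rcases hmem with h | h
    · exact hφE (Or.inl (by rw [← hvE, h, Complex.ofReal_zero]))
    · exact hφE (Or.inr (by rw [← hvE, h, Complex.ofReal_one]))
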